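/- Let $(\bar M,J,g)$ be a metallic Riemannian manifold: $\bar M$ is a smooth finite-dimensional manifold without boundary, $g$ is a smooth Riemannian metric on $\bar M$, and $J$ is a smooth $(1,1)$-tensor field on $\bar M$ such that $J^2=pJ+q\,\mathrm{Id}$ for some positive integers $p,q$ and $g(JU,V)=g(U,JV)$ for all tangent vectors $U,V$ at the same point. Let $M$ be a smooth finite-dimensional Riemannian manifold without boundary and $f:M\to\bar M$ an isometric immersion, that is, a smooth map with $g(df_x u,df_x v)=g(u,v)$ for all $x\in M$ and $u,v\in T_xM$ (the metric of $M$ is also denoted by $g$). For $x\in M$ identify $T_xM$ with $df_x(T_xM)\subset T_{f(x)}\bar M$, and let $T$ be the field of endomorphisms of $TM$ defined by $TX:=(JX)^T$, where $(\cdot)^T$ is the $g$-orthogonal projection of $T_{f(x)}\bar M$ onto $T_xM$. Let $\nabla$ be the Levi-Civita connection of $(M,g)$ and $(\nabla_XT)Y:=\nabla_X(TY)-T(\nabla_XY)$. Then $$g((\nabla_XT)Y,Z)=g(Y,(\nabla_XT)Z)$$ for all smooth vector fields $X,Y,Z$ on $M$. -/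

import Mathlib

open Bundle Manifold
open scoped Manifold ContDiff

set_option linter.unusedSectionVars false

noncomputable section

namespace MetallicGeometry

section Connection

variable {E : Type*} [NormedAddCommGroup E] [NormedSpace ℝ E]
  {H : Type*} [TopologicalSpace H] (I : ModelWithCorners ℝ E H)
  {M : Type*} [TopologicalSpace M] [ChartedSpace H M]
  [IsManifold I ∞ M]
  [RiemannianBundle (fun x : M => TangentSpace I x)]

/-- The right-hand side of the Koszul formula for `2 g(∇_X Y, Z)`, at the point `x`. -/
def koszul (X Y Z : Π x : M, TangentSpace I x) (x : M) : ℝ :=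
  mvfderiv I (fun y => inner ℝ (Y y) (Z y)) x (X x)
    + mvfderiv I (fun y => inner ℝ (X y) (Z y)) x (Y x)
    - mvfderiv I (fun y => inner ℝ (X y) (Y y)) x (Z x)
    + inner ℝ (VectorField.mlieBracket I X Y x) (Z x)
    - inner ℝ (VectorField.mlieBracket I X Z x) (Y x)
    - inner ℝ (VectorField.mlieBracket I Y Z x) (X x)

variable [FiniteDimensional ℝ E]
  [IsContMDiffRiemannianBundle I ∞ E (fun x : M => TangentSpace I x)]

variable {I}

theorem mdifferentiableAt_inner {x : M} {X Y : Π x : M, TangentSpace I x}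
    (hX : MDiffAt (T% X) x) (hY : MDiffAt (T% Y) x) :
    MDiffAt (fun y => (inner ℝ (X y) (Y y) : ℝ)) x :=
  MDifferentiableAt.inner_bundle (F := E) (E := fun y : M => TangentSpace I y)
    (b := fun y => y) hX hY

theorem koszul_tensorial_left {x : M} {Y Z : Π x : M, TangentSpace I x}
    (hY : MDiffAt (T% Y) x) (hZ : MDiffAt (T% Z) x) :
    TensorialAt I E (fun X : Π x : M, TangentSpace I x => koszul I X Y Z x) x where
  smul {f X} hf hX := by
    have := FiniteDimensional.complete ℝ E
    simp only [koszul, Pi.smul_apply', inner_smul_left, map_smul, smul_eq_mul,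
      VectorField.mlieBracket_smul_left hf hX, inner_add_left, conj_trivial,
      mvfderiv_fun_mul hf (mdifferentiableAt_inner hX hZ),
      mvfderiv_fun_mul hf (mdifferentiableAt_inner hX hY)]
    simp [real_inner_comm, inner_smul_right]
    ring
  add {X X'} hX hX' := by
    have := FiniteDimensional.complete ℝ E
    simp only [koszul, Pi.add_apply, inner_add_left, inner_add_right, map_add,
      VectorField.mlieBracket_add_left hX hX',
      mvfderiv_fun_add (mdifferentiableAt_inner hX hZ) (mdifferentiableAt_inner hX' hZ),
      mvfderiv_fun_add (mdifferentiableAt_inner hX hY) (mdifferentiableAt_inner hX' hY)]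
    simp
    ring

theorem koszul_tensorial_right {x : M} {X Y : Π x : M, TangentSpace I x}
    (hX : MDiffAt (T% X) x) (hY : MDiffAt (T% Y) x) :
    TensorialAt I E (fun Z : Π x : M, TangentSpace I x => koszul I X Y Z x) x where
  smul {f Z} hf hZ := by
    have := FiniteDimensional.complete ℝ E
    simp only [koszul, Pi.smul_apply', inner_smul_right, map_smul, smul_eq_mul,
      VectorField.mlieBracket_smul_right hf hZ, inner_add_left, inner_smul_left, conj_trivial,
      mvfderiv_fun_mul hf (mdifferentiableAt_inner hX hZ),
      mvfderiv_fun_mul hf (mdifferentiableAt_inner hY hZ)]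
    simp [real_inner_comm]
    ring
  add {Z Z'} hZ hZ' := by
    have := FiniteDimensional.complete ℝ E
    simp only [koszul, Pi.add_apply, inner_add_left, inner_add_right, map_add,
      VectorField.mlieBracket_add_right hZ hZ',
      mvfderiv_fun_add (mdifferentiableAt_inner hX hZ) (mdifferentiableAt_inner hX hZ'),
      mvfderiv_fun_add (mdifferentiableAt_inner hY hZ) (mdifferentiableAt_inner hY hZ')]
    simp
    ring

/-- The bilinear form `(v, w) ↦ 2 g(∇_v Y, w)` on `T_x M` given by the Koszul formula. -/
def koszulForm (Y : Π x : M, TangentSpace I x) (x : M) (hY : MDiffAt (T% Y) x) :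
    TangentSpace I x →L[ℝ] TangentSpace I x →L[ℝ] ℝ :=
  TensorialAt.mkHom₂ (I := I) (F := E) (F' := E) (fun X Z => koszul I X Y Z x) x
    (fun _ hZ => koszul_tensorial_left hY hZ) (fun _ hX => koszul_tensorial_right hX hY)

theorem koszulForm_apply {X Y Z : Π x : M, TangentSpace I x} {x : M}
    (hX : MDiffAt (T% X) x) (hY : MDiffAt (T% Y) x) (hZ : MDiffAt (T% Z) x) :
    koszulForm Y x hY (X x) (Z x) = koszul I X Y Z x :=
  TensorialAt.mkHom₂_apply _ _ hX hZ

instance instCompleteTangent (x : M) : CompleteSpace (TangentSpace I x) :=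
  have : FiniteDimensional ℝ (TangentSpace I x) := inferInstanceAs (FiniteDimensional ℝ E)
  FiniteDimensional.complete ℝ (TangentSpace I x)

open Classical in
/-- The Levi-Civita derivative: `leviCivitaFun Y x v` is `∇_v Y`, the vector with
`2 g(∇_v Y, w) = koszulForm Y x v w` for all `w`. Fields which are not differentiable at `x` get the
junk value `0` there. -/
def leviCivitaFun (Y : Π x : M, TangentSpace I x) (x : M) :
    TangentSpace I x →L[ℝ] TangentSpace I x :=
  if hY : MDiffAt (T% Y) x then
    (1 / 2 : ℝ) • ((InnerProductSpace.toDual ℝ (TangentSpace I x)).symm.toContinuousLinearEquiv.toContinuousLinearMap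
      ∘SL koszulForm Y x hY)
  else 0

theorem inner_leviCivitaFun {X Y Z : Π x : M, TangentSpace I x} {x : M}
    (hX : MDiffAt (T% X) x) (hY : MDiffAt (T% Y) x) (hZ : MDiffAt (T% Z) x) :
    inner ℝ (leviCivitaFun Y x (X x)) (Z x) = 1 / 2 * koszul I X Y Z x := by
  rw [← koszulForm_apply hX hY hZ, leviCivitaFun, dif_pos hY]
  simp [inner_smul_left]

/-- Two endomorphisms of `T_x M` agree if they have the same `g`-components on fields which are
differentiable at `x`. -/
theorem tangent_hom_ext {x : M} {A B : TangentSpace I x →L[ℝ] TangentSpace I x}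
    (h : ∀ X Z : Π x : M, TangentSpace I x, MDiffAt (T% X) x → MDiffAt (T% Z) x →
      (inner ℝ (A (X x)) (Z x) : ℝ) = inner ℝ (B (X x)) (Z x)) : A = B := by
  ext v
  refine ext_inner_right ℝ fun w => ?_
  have := h (FiberBundle.extend E v) (FiberBundle.extend E w)
    (FiberBundle.mdifferentiableAt_extend I E v) (FiberBundle.mdifferentiableAt_extend I E w)
  simpa using this

variable (I M) in
/-- The Levi-Civita connection of a Riemannian manifold. -/
def leviCivita : CovariantDerivative I E (TangentSpace I : M → Type _) where
  toFun := leviCivitaFun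
  isCovariantDerivativeOnUniv :=
    { add := by
        intro Y Y' x hY hY' _
        have := FiniteDimensional.complete ℝ E
        refine tangent_hom_ext fun X Z hX hZ => ?_
        rw [inner_leviCivitaFun hX (mdifferentiableAt_add_section hY hY') hZ,
          add_apply, inner_add_left, inner_leviCivitaFun hX hY hZ,
          inner_leviCivitaFun hX hY' hZ]
        simp only [koszul, Pi.add_apply, inner_add_left, inner_add_right, map_add,
          VectorField.mlieBracket_add_left hY hY', VectorField.mlieBracket_add_right hY hY',
          mvfderiv_fun_add (mdifferentiableAt_inner hY hZ) (mdifferentiableAt_inner hY' hZ),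
          mvfderiv_fun_add (mdifferentiableAt_inner hX hY) (mdifferentiableAt_inner hX hY')]
        simp
        ring
      leibniz := by
        intro Y f x hY hf _
        have := FiniteDimensional.complete ℝ E
        refine tangent_hom_ext fun X Z hX hZ => ?_
        rw [inner_leviCivitaFun hX (hf.smul_section hY) hZ, add_apply,
          inner_add_left, smul_apply, inner_smul_left,
          inner_leviCivitaFun hX hY hZ]
        simp only [koszul, Pi.smul_apply', inner_smul_left, inner_smul_right, map_smul,
          smul_eq_mul, VectorField.mlieBracket_smul_left hf hY,
          VectorField.mlieBracket_smul_right hf hY, inner_add_left, conj_trivial,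
          mvfderiv_fun_mul hf (mdifferentiableAt_inner hY hZ),
          mvfderiv_fun_mul hf (mdifferentiableAt_inner hX hY)]
        simp [real_inner_comm, inner_smul_left]
        ring }

theorem inner_leviCivita {X Y Z : Π x : M, TangentSpace I x} {x : M}
    (hX : MDiffAt (T% X) x) (hY : MDiffAt (T% Y) x) (hZ : MDiffAt (T% Z) x) :
    inner ℝ (leviCivita I M Y x (X x)) (Z x) = 1 / 2 * koszul I X Y Z x :=
  inner_leviCivitaFun hX hY hZ

/-- The Levi-Civita connection is metric. -/
theorem leviCivita_metric {X Y Z : Π x : M, TangentSpace I x} {x : M}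
    (hX : MDiffAt (T% X) x) (hY : MDiffAt (T% Y) x) (hZ : MDiffAt (T% Z) x) :
    mvfderiv I (fun y => inner ℝ (Y y) (Z y)) x (X x) =
      inner ℝ (leviCivita I M Y x (X x)) (Z x) + inner ℝ (Y x) (leviCivita I M Z x (X x)) := by
  rw [real_inner_comm _ (Y x), inner_leviCivita hX hY hZ, inner_leviCivita hX hZ hY]
  simp only [koszul]
  rw [VectorField.mlieBracket_swap_apply (V := Z) (W := Y)]
  simp [real_inner_comm]
  ring

/-- The Levi-Civita connection is torsion-free. -/
theorem leviCivita_torsion {X Y : Π x : M, TangentSpace I x} {x : M}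
    (hX : MDiffAt (T% X) x) (hY : MDiffAt (T% Y) x) :
    leviCivita I M Y x (X x) - leviCivita I M X x (Y x) = VectorField.mlieBracket I X Y x := by
  refine ext_inner_right ℝ fun w => ?_
  have hw := FiberBundle.mdifferentiableAt_extend I E w
  have h1 := inner_leviCivita hX hY hw
  have h2 := inner_leviCivita hY hX hw
  simp only [FiberBundle.extend_apply_self] at h1 h2
  rw [inner_sub_left, h1, h2]
  simp only [koszul]
  rw [VectorField.mlieBracket_swap_apply (V := Y) (W := X)]
  simp [real_inner_comm]
  ring

/-- The covariant derivative `(∇_X T) Y = ∇_X (T Y) - T (∇_X Y)` of a field of endomorphisms `T`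
of the tangent bundle, with respect to the Levi-Civita connection. -/
def covDerivEnd (T : Π x : M, TangentSpace I x →L[ℝ] TangentSpace I x)
    (X Y : Π x : M, TangentSpace I x) (x : M) : TangentSpace I x :=
  leviCivita I M (fun y => T y (Y y)) x (X x) - T x (leviCivita I M Y x (X x))

end Connection

section Metallic

variable {E : Type*} [NormedAddCommGroup E] [NormedSpace ℝ E]
  {H : Type*} [TopologicalSpace H] (I : ModelWithCorners ℝ E H)
  {M : Type*} [TopologicalSpace M] [ChartedSpace H M]
  [IsManifold I ∞ M]

/-- A metallic structure: a smooth (1,1)-tensor field `J` with `J² = p J + q Id` for some positive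
integers `p` and `q`. -/
structure IsMetallic (J : Π x : M, TangentSpace I x →L[ℝ] TangentSpace I x) : Prop where
  contMDiff : ContMDiff I (I.prod 𝓘(ℝ, E →L[ℝ] E)) ∞
    (fun x => TotalSpace.mk' (E →L[ℝ] E)
      (E := fun x : M => TangentSpace I x →L[ℝ] TangentSpace I x) x (J x))
  sq_eq : ∃ p q : ℕ, 0 < p ∧ 0 < q ∧
    ∀ (x : M) (v : TangentSpace I x), J x (J x v) = (p : ℝ) • J x v + (q : ℝ) • v

/-- `(J, g)` is a metallic Riemannian structure, where `g` is the Riemannian metric given by the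
inner products on the tangent spaces. -/
structure IsMetallicRiemannian [RiemannianBundle (fun x : M => TangentSpace I x)]
    (J : Π x : M, TangentSpace I x →L[ℝ] TangentSpace I x) : Prop extends IsMetallic I J where
  compatible : ∀ (x : M) (v w : TangentSpace I x),
    (inner ℝ (J x v) w : ℝ) = inner ℝ v (J x w)

end Metallic

section Immersion

variable {E : Type*} [NormedAddCommGroup E] [NormedSpace ℝ E] [FiniteDimensional ℝ E]
  {H : Type*} [TopologicalSpace H] (I : ModelWithCorners ℝ E H)
  {M : Type*} [TopologicalSpace M] [ChartedSpace H M]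
  [RiemannianBundle (fun x : M => TangentSpace I x)]
  {E' : Type*} [NormedAddCommGroup E'] [NormedSpace ℝ E']
  {H' : Type*} [TopologicalSpace H'] (I' : ModelWithCorners ℝ E' H')
  {N : Type*} [TopologicalSpace N] [ChartedSpace H' N]
  [RiemannianBundle (fun x : N => TangentSpace I' x)]

/-- An isometric immersion `f : M → N`: a smooth map whose differentials preserve the Riemannian
metrics. In particular they are injective. -/
structure IsIsometricImmersion (f : M → N) : Prop where
  contMDiff : ContMDiff I I' ∞ f
  inner_mfderiv : ∀ (x : M) (v w : TangentSpace I x),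
    (inner ℝ (mfderiv I I' f x v) (mfderiv I I' f x w) : ℝ) = inner ℝ v w

variable {I I'} {f : M → N}

/-- The differential of an isometric immersion at `x`, as a linear isometry
`T_x M → T_{f x} N`. -/
def IsIsometricImmersion.differential (hf : IsIsometricImmersion I I' f) (x : M) :
    TangentSpace I x →ₗᵢ[ℝ] TangentSpace I' (f x) :=
  (mfderiv I I' f x : TangentSpace I x →ₗ[ℝ] TangentSpace I' (f x)).isometryOfInner
    (hf.inner_mfderiv x)

instance instFiniteDimensionalTangent (x : M) : FiniteDimensional ℝ (TangentSpace I x) :=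
  inferInstanceAs (FiniteDimensional ℝ E)

/-- The tangential part `w^T ∈ T_x M` of `w ∈ T_{f x} N`: its orthogonal projection to
`df_x (T_x M)`, where `df_x` identifies `T_x M` with its image. -/
def IsIsometricImmersion.tangentialPart (hf : IsIsometricImmersion I I' f) (x : M) :
    TangentSpace I' (f x) →L[ℝ] TangentSpace I x :=
  (hf.differential x).equivRange.symm.toContinuousLinearEquiv.toContinuousLinearMap ∘SL
    (LinearMap.range (hf.differential x).toLinearMap).orthogonalProjectionOnto

/-- The tangential part `T X = (J X)^T` of `J` along an isometric immersion. -/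
def IsIsometricImmersion.tangentialEnd (hf : IsIsometricImmersion I I' f)
    (J : Π x : N, TangentSpace I' x →L[ℝ] TangentSpace I' x) (x : M) :
    TangentSpace I x →L[ℝ] TangentSpace I x :=
  hf.tangentialPart x ∘SL J (f x) ∘SL (hf.differential x).toContinuousLinearMap

end Immersion

end MetallicGeometry

end

section Inverse

variable {E : Type*} [NormedAddCommGroup E] [NormedSpace ℝ E]
  {H : Type*} [TopologicalSpace H] {I : ModelWithCorners ℝ E H}
  {M : Type*} [TopologicalSpace M] [ChartedSpace H M]

theorem mdifferentiableAt_pi_space {ι : Type*} [Fintype ι] {φ : M → ι → ℝ} {x : M} :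
    MDifferentiableAt I 𝓘(ℝ, ι → ℝ) φ x ↔ ∀ i, MDiffAt (fun y => φ y i) x := by
  simp only [mdifferentiableAt_iff, differentiableWithinAt_pi, continuousAt_pi, ← forall_and]
  rfl

/-- The solution of a differentiable family of uniquely solvable linear systems is
differentiable. -/
theorem mdifferentiableAt_of_linear_system {ι : Type*} [Fintype ι] {x : M}
    {G : ι → ι → M → ℝ} {c : ι → M → ℝ}
    (hG : ∀ i j, MDiffAt (G i j) x) (hdet : ∀ v : ι → ℝ, (∀ i, ∑ j, G i j x * v j = 0) → v = 0)
    (hc : ∀ i, MDiffAt (fun y => ∑ j, G i j y * c j y) x) (i : ι) : MDiffAt (c i) x := by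
  classical
  let L : (ι × ι → ℝ) →ₗ[ℝ] ((ι → ℝ) →L[ℝ] (ι → ℝ)) :=
    { toFun := fun g => LinearMap.toContinuousLinearMap
        (Matrix.mulVecLin (Matrix.of fun i j => g (i, j)))
      map_add' := by
        intro g h
        ext v i
        simp [Matrix.mulVec, dotProduct, add_mul, Finset.sum_add_distrib]
      map_smul' := by
        intro a g
        ext v i
        simp [Matrix.mulVec, dotProduct, Finset.mul_sum, mul_assoc] }
  have hL (g : ι × ι → ℝ) (v : ι → ℝ) (i : ι) : L g v i = ∑ j, g (i, j) * v j := rfl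
  let A : M → ((ι → ℝ) →L[ℝ] (ι → ℝ)) := fun y => L fun p => G p.1 p.2 y
  have hA : MDiffAt A x := by
    have h1 : MDifferentiableAt I 𝓘(ℝ, ι × ι → ℝ) (fun y => fun p : ι × ι => G p.1 p.2 y) x :=
      mdifferentiableAt_pi_space.2 fun p => hG p.1 p.2
    exact (L.toContinuousLinearMap.mdifferentiableAt).comp x h1
  have hinj : Function.Injective (A x).toLinearMap := by
    rw [injective_iff_map_eq_zero]
    exact fun v hv => hdet v fun i => congrFun hv i
  let e : (ι → ℝ) ≃L[ℝ] (ι → ℝ) :=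
    (LinearEquiv.ofInjectiveEndo (A x).toLinearMap hinj).toContinuousLinearEquiv
  have he : (e : (ι → ℝ) →L[ℝ] (ι → ℝ)) = A x := by
    ext v i
    rfl
  have hinv : MDiffAt (fun y => (A y).inverse) x := by
    have h2 : DifferentiableAt ℝ ContinuousLinearMap.inverse (A x) := by
      rw [← he]
      exact (contDiffAt_map_inverse (n := 1) e).differentiableAt one_ne_zero
    exact h2.mdifferentiableAt.comp x hA
  have hφ : MDifferentiableAt I 𝓘(ℝ, ι → ℝ) (fun y => A y fun j => c j y) x :=
    mdifferentiableAt_pi_space.2 hc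
  have hmain : MDifferentiableAt I 𝓘(ℝ, ι → ℝ)
      (fun y => (A y).inverse (A y fun j => c j y)) x := hinv.clm_apply hφ
  have hev : ∀ᶠ y in nhds x, (A y).inverse (A y fun j => c j y) = fun j => c j y := by
    have : ∀ᶠ y in nhds x, A y ∈ Set.range
        ((↑) : ((ι → ℝ) ≃L[ℝ] (ι → ℝ)) → ((ι → ℝ) →L[ℝ] (ι → ℝ))) :=
      hA.continuousAt.eventually (he ▸ ContinuousLinearEquiv.nhds e)
    filter_upwards [this] with y ⟨e', he'⟩
    rw [← he']
    simp
  exact mdifferentiableAt_pi_space.1 (hmain.congr_of_eventuallyEq (hev.mono fun _ h => h.symm)) i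

end Inverse

namespace MetallicGeometry

section Frame

variable {E : Type*} [NormedAddCommGroup E] [NormedSpace ℝ E] [FiniteDimensional ℝ E]
  {H : Type*} [TopologicalSpace H] {I : ModelWithCorners ℝ E H}
  {M : Type*} [TopologicalSpace M] [ChartedSpace H M] [IsManifold I ∞ M]
  [RiemannianBundle (fun x : M => TangentSpace I x)]
  [IsContMDiffRiemannianBundle I ∞ E (fun x : M => TangentSpace I x)]

/-- A vector field is differentiable at `x` if its inner products with all vector fields which are
differentiable at `x` are differentiable at `x`. -/
theorem mdifferentiableAt_of_inner {x : M} {V : Π x : M, TangentSpace I x}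
    (h : ∀ W : Π x : M, TangentSpace I x, MDiffAt (T% W) x →
      MDiffAt (fun y => (inner ℝ (V y) (W y) : ℝ)) x) : MDiffAt (T% V) x := by
  let e := trivializationAt E (fun x : M => TangentSpace I x) x
  let b := Module.finBasis ℝ E
  have hx : x ∈ e.baseSet := FiberBundle.mem_baseSet_trivializationAt' x
  have hs (i) : MDiffAt (T% (e.localFrame b i)) x :=
    (contMDiffAt_localFrame_of_mem 1 e b i hx).mdifferentiableAt one_ne_zero
  rw [mdifferentiableAt_iff_localFrameCoeff (I := I) b hx]
  refine mdifferentiableAt_of_linear_system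
    (G := fun i j y => inner ℝ (e.localFrame b j y) (e.localFrame b i y))
    (fun i j => mdifferentiableAt_inner (hs j) (hs i)) ?_ ?_
  · intro v hv
    have hz : ∑ j, v j • e.localFrame b j x = 0 := by
      rw [← inner_self_eq_zero (𝕜 := ℝ), inner_sum]
      refine Finset.sum_eq_zero fun i _ => ?_
      rw [inner_smul_right, sum_inner]
      simp only [inner_smul_left, conj_trivial, mul_comm (v _), hv i, zero_mul]
    have hli := (e.isLocalFrameOn_localFrame_baseSet I 1 b).linearIndependent hx
    exact funext (Fintype.linearIndependent_iff.1 hli v hz)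
  · intro i
    refine (h _ (hs i)).congr_of_eventuallyEq ?_
    filter_upwards [e.eventually_eq_localFrame_sum_coeff_smul (I := I) (s := V) b hx] with y hy
    conv_rhs => rw [hy, sum_inner]
    exact Finset.sum_congr rfl fun j _ => by
      rw [inner_smul_left, conj_trivial, mul_comm]
      rfl

/-- The covariant derivative of a field of self-adjoint endomorphisms is self-adjoint. -/
theorem inner_covDerivEnd {T : Π x : M, TangentSpace I x →L[ℝ] TangentSpace I x}
    (hT : ∀ x v w, (inner ℝ (T x v) w : ℝ) = inner ℝ v (T x w))
    {X Y Z : Π x : M, TangentSpace I x} {x : M}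
    (hX : MDiffAt (T% X) x) (hY : MDiffAt (T% Y) x) (hZ : MDiffAt (T% Z) x)
    (hTY : MDiffAt (T% (fun y => T y (Y y))) x) (hTZ : MDiffAt (T% (fun y => T y (Z y))) x) :
    (inner ℝ (covDerivEnd T X Y x) (Z x) : ℝ) = inner ℝ (Y x) (covDerivEnd T X Z x) := by
  have h1 := leviCivita_metric hX hTY hZ
  have h2 := leviCivita_metric hX hY hTZ
  simp only [hT] at h1
  rw [h1] at h2
  simp only [covDerivEnd, inner_sub_left, inner_sub_right, hT]
  linarith

end Frame

section Immersion

variable {E : Type*} [NormedAddCommGroup E] [NormedSpace ℝ E] [FiniteDimensional ℝ E]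
  {H : Type*} [TopologicalSpace H] {I : ModelWithCorners ℝ E H}
  {M : Type*} [TopologicalSpace M] [ChartedSpace H M]
  [RiemannianBundle (fun x : M => TangentSpace I x)]
  {E' : Type*} [NormedAddCommGroup E'] [NormedSpace ℝ E']
  {H' : Type*} [TopologicalSpace H'] {I' : ModelWithCorners ℝ E' H'}
  {N : Type*} [TopologicalSpace N] [ChartedSpace H' N]
  [RiemannianBundle (fun x : N => TangentSpace I' x)]
  {f : M → N}

/-- The tangential part is the adjoint of the differential. -/
theorem IsIsometricImmersion.inner_tangentialPart (hf : IsIsometricImmersion I I' f) (x : M)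
    (w : TangentSpace I' (f x)) (v : TangentSpace I x) :
    (inner ℝ (hf.tangentialPart x w) v : ℝ) = inner ℝ w (mfderiv I I' f x v) := by
  rw [← (hf.differential x).inner_map_map]
  have h1 : hf.differential x (hf.tangentialPart x w) =
      (LinearMap.range (hf.differential x).toLinearMap).orthogonalProjectionOnto w :=
    congrArg Subtype.val ((hf.differential x).equivRange.apply_symm_apply _)
  rw [h1]
  exact Submodule.inner_orthogonalProjectionOnto_eq_of_mem_right
    (⟨hf.differential x v, LinearMap.mem_range_self _ v⟩ :
      LinearMap.range (hf.differential x).toLinearMap) w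

theorem IsIsometricImmersion.inner_tangentialEnd (hf : IsIsometricImmersion I I' f)
    (J : Π x : N, TangentSpace I' x →L[ℝ] TangentSpace I' x) (x : M)
    (v w : TangentSpace I x) :
    (inner ℝ (hf.tangentialEnd J x v) w : ℝ) =
      inner ℝ (J (f x) (mfderiv I I' f x v)) (mfderiv I I' f x w) :=
  hf.inner_tangentialPart x _ w

/-- The tangential part of a self-adjoint field of endomorphisms is self-adjoint. -/
theorem IsIsometricImmersion.tangentialEnd_selfAdjoint (hf : IsIsometricImmersion I I' f)
    {J : Π x : N, TangentSpace I' x →L[ℝ] TangentSpace I' x}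
    (hJ : ∀ x v w, (inner ℝ (J x v) w : ℝ) = inner ℝ v (J x w)) (x : M)
    (v w : TangentSpace I x) :
    (inner ℝ (hf.tangentialEnd J x v) w : ℝ) = inner ℝ v (hf.tangentialEnd J x w) := by
  rw [hf.inner_tangentialEnd, hJ, real_inner_comm, ← hf.inner_tangentialEnd, real_inner_comm]

variable [IsManifold I ∞ M] [IsManifold I' ∞ N]

/-- The image of a differentiable vector field under the differential is differentiable along the
map. -/
theorem IsIsometricImmersion.mdifferentiableAt_mfderiv_apply (hf : IsIsometricImmersion I I' f)
    {x : M} {W : Π x : M, TangentSpace I x} (hW : MDiffAt (T% W) x) :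
    MDiffAt (fun y => (⟨f y, mfderiv I I' f y (W y)⟩ : TangentBundle I' N)) x := by
  have h1 : ContMDiff I.tangent I'.tangent 1 (tangentMap I I' f) :=
    (hf.contMDiff.of_le (ENat.LEInfty.out : (2 : ℕ∞ω) ≤ ∞)).contMDiff_tangentMap (by norm_num)
  exact ((h1.mdifferentiable one_ne_zero) _).comp x hW

/-- The tangential part of a smooth field of endomorphisms maps differentiable vector fields to
differentiable vector fields. -/
theorem IsIsometricImmersion.mdifferentiableAt_tangentialEnd
    [IsContMDiffRiemannianBundle I ∞ E (fun x : M => TangentSpace I x)]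
    [IsContMDiffRiemannianBundle I' ∞ E' (fun x : N => TangentSpace I' x)]
    (hf : IsIsometricImmersion I I' f)
    {J : Π x : N, TangentSpace I' x →L[ℝ] TangentSpace I' x}
    (hJ : ContMDiff I' (I'.prod 𝓘(ℝ, E' →L[ℝ] E')) ∞
      (fun x => TotalSpace.mk' (E' →L[ℝ] E')
        (E := fun x : N => TangentSpace I' x →L[ℝ] TangentSpace I' x) x (J x)))
    {x : M} {V : Π x : M, TangentSpace I x} (hV : MDiffAt (T% V) x) :
    MDiffAt (T% (fun y => hf.tangentialEnd J y (V y))) x := by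
  refine mdifferentiableAt_of_inner fun W hW => ?_
  simp only [hf.inner_tangentialEnd]
  have hJf : MDiffAt (fun y => TotalSpace.mk' (E' →L[ℝ] E')
      (E := fun x : N => TangentSpace I' x →L[ℝ] TangentSpace I' x) (f y) (J (f y))) x :=
    ((hJ.comp hf.contMDiff).mdifferentiable (by simp)) x
  exact MDifferentiableAt.inner_bundle (F := E') (E := fun y : N => TangentSpace I' y) (b := f)
    (hJf.clm_bundle_apply (hf.mdifferentiableAt_mfderiv_apply hV))
    (hf.mdifferentiableAt_mfderiv_apply hW)

end Immersion

end MetallicGeometry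

theorem mainTheorem5
    {E : Type*} [NormedAddCommGroup E] [NormedSpace ℝ E] [FiniteDimensional ℝ E]
    {H : Type*} [TopologicalSpace H] {I : ModelWithCorners ℝ E H}
    {M : Type*} [TopologicalSpace M] [ChartedSpace H M]
    [IsManifold I ∞ M] [BoundarylessManifold I M]
    [RiemannianBundle (fun x : M => TangentSpace I x)]
    [IsContMDiffRiemannianBundle I ∞ E (fun x : M => TangentSpace I x)]
    {E' : Type*} [NormedAddCommGroup E'] [NormedSpace ℝ E'] [FiniteDimensional ℝ E']
    {H' : Type*} [TopologicalSpace H'] {I' : ModelWithCorners ℝ E' H'}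
    {N : Type*} [TopologicalSpace N] [ChartedSpace H' N]
    [IsManifold I' ∞ N] [BoundarylessManifold I' N]
    [RiemannianBundle (fun x : N => TangentSpace I' x)]
    [IsContMDiffRiemannianBundle I' ∞ E' (fun x : N => TangentSpace I' x)]
    (J : Π x : N, TangentSpace I' x →L[ℝ] TangentSpace I' x)
    (hJ : MetallicGeometry.IsMetallicRiemannian I' J)
    (f : M → N) (hf : MetallicGeometry.IsIsometricImmersion I I' f)
    (X Y Z : Π x : M, TangentSpace I x)
    (hX : ContMDiff I I.tangent ∞ (fun x => (⟨x, X x⟩ : TangentBundle I M)))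
    (hY : ContMDiff I I.tangent ∞ (fun x => (⟨x, Y x⟩ : TangentBundle I M)))
    (hZ : ContMDiff I I.tangent ∞ (fun x => (⟨x, Z x⟩ : TangentBundle I M)))
    (x : M) :
    (inner ℝ (MetallicGeometry.covDerivEnd (hf.tangentialEnd J) X Y x) (Z x) : ℝ) =
      inner ℝ (Y x) (MetallicGeometry.covDerivEnd (hf.tangentialEnd J) X Z x) := by
  have hX' := hX.mdifferentiable (by simp) x
  have hY' := hY.mdifferentiable (by simp) x
  have hZ' := hZ.mdifferentiable (by simp) x
  exact MetallicGeometry.inner_covDerivEnd (hf.tangentialEnd_selfAdjoint hJ.compatible) hX' hY' hZ'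
    (hf.mdifferentiableAt_tangentialEnd hJ.contMDiff hY')
    (hf.mdifferentiableAt_tangentialEnd hJ.contMDiff hZ')
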